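/- Let $X$ be an irreducible complex affine surface, that is, $X=\operatorname{Spec} A$ where $A=\mathcal O_X$ is a finitely generated $\mathbb C$-algebra which is an integral domain of Krull dimension $2$. Assume that $X$ is locally a complete intersection, and let $f:X\to\mathbb C$ be a dominant morphism, i.e. an element $f\in A$ such that the morphism $\operatorname{Spec}A\to\mathbb A^1$ it defines is dominant. Let $\operatorname{Sing}(f)$ be the set of (closed) points $x\in X$ such that either $X$ is singular at $x$ or $df$ vanishes at $x$ (i.e. $df\in\mathfrak m_x\Omega^1(X)$). Let $\Omega^0(X)=A$, let $\Omega^1(X)=\Omega^1_{A/\mathbb C}$ be the module of regular (Kähler) $1$-forms, and let $$H^1(f)=\frac{\Omega^1(X)}{d\Omega^0(X)+\Omega^0(X)\,df},$$ regarded as a $\mathbb C[f]$-module via $(P(f),\omega)\mapsto P(f)\omega$. Let $y\in\mathbb C$ be such that $f^{-1}(y)\cap\operatorname{Sing}(f)$ is finite. Then $H^1(f)$ has property $\mathcal P(y)$: for every integer $r\ge 0$ and every $\omega\in H^1(f)$, $$(f-y)^r\omega=0\ \text{ in } H^1(f)\quad\Longrightarrow\quad \omega\in (f-y)H^1(f).$$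 -/

import Mathlib

open scoped Polynomial

noncomputable section

namespace RelCohomology

/-- The affine `ℂ`-scheme `Spec A` is locally a complete intersection: for some closed embedding in
an affine space `𝔸ⁿ`, given by a surjection `π : ℂ[x₁, …, xₙ] → A`, the ideal `ker π` is generated
by a regular sequence in the local ring of `𝔸ⁿ` at each closed point of `Spec A`. -/
def IsLocallyCompleteIntersection (A : Type*) [CommRing A] [Algebra ℂ A] : Prop :=
  ∃ (n : ℕ) (π : MvPolynomial (Fin n) ℂ →ₐ[ℂ] A), Function.Surjective π ∧
    ∀ x : MaximalSpectrum A,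
      ∃ rs : List (Localization.AtPrime (x.asIdeal.comap π)),
        RingTheory.Sequence.IsRegular (Localization.AtPrime (x.asIdeal.comap π)) rs ∧
        Ideal.ofList rs = (RingHom.ker π).map
          (algebraMap (MvPolynomial (Fin n) ℂ) (Localization.AtPrime (x.asIdeal.comap π)))

variable {A : Type*} [CommRing A] [Algebra ℂ A]

/-- The morphism `Spec A → 𝔸¹ = Spec ℂ[t]` given by the regular function `f` (that is, by
`t ↦ f`) is dominant. -/
def IsDominantFunction (f : A) : Prop :=
  DenseRange (PrimeSpectrum.comap (Polynomial.aeval f : ℂ[X] →ₐ[ℂ] A).toRingHom)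

/-- The closed points of the fibre `f⁻¹(y)`. -/
def fibre (f : A) (y : ℂ) : Set (MaximalSpectrum A) :=
  {x | f - algebraMap ℂ A y ∈ x.asIdeal}

/-- The singular set of `f`: the closed points `x` of `X = Spec A` such that either `X` is not
smooth at `x`, or `df` vanishes at `x`, i.e. `df ∈ 𝔪ₓ Ω¹(X)`. -/
def singularSet (f : A) : Set (MaximalSpectrum A) :=
  {x | x.toPrimeSpectrum ∉ Algebra.smoothLocus ℂ A ∨
    KaehlerDifferential.D ℂ A f ∈ x.asIdeal • (⊤ : Submodule A (Ω[A⁄ℂ]))}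

/-- The subalgebra `ℂ[f]` of `A`. -/
abbrev polyIn (f : A) : Subalgebra ℂ A := Algebra.adjoin ℂ {f}

/-- `f` as an element of `ℂ[f]`. -/
def gen (f : A) : polyIn f := ⟨f, Algebra.self_mem_adjoin_singleton ℂ f⟩

/-- For `p ∈ ℂ[f]` the differential `dp` is a multiple of `df`. -/
theorem exists_D_eq_smul (f : A) {p : A} (hp : p ∈ polyIn f) :
    ∃ q : A, KaehlerDifferential.D ℂ A p = q • KaehlerDifferential.D ℂ A f := by
  induction hp using Algebra.adjoin_induction with
  | mem x hx => exact ⟨1, by rw [Set.mem_singleton_iff.1 hx, one_smul]⟩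
  | algebraMap r => exact ⟨0, by simp⟩
  | add x y _ _ hx hy =>
    obtain ⟨a, ha⟩ := hx
    obtain ⟨b, hb⟩ := hy
    exact ⟨a + b, by rw [map_add, ha, hb, add_smul]⟩
  | mul x y _ _ hx hy =>
    obtain ⟨a, ha⟩ := hx
    obtain ⟨b, hb⟩ := hy
    exact ⟨x * b + y * a, by rw [Derivation.leibniz, ha, hb, add_smul, mul_smul, mul_smul]⟩

/-- The `ℂ[f]`-submodule `dΩ⁰(X) + Ω⁰(X) df` of `Ω¹(X)`. -/
def relExact (f : A) : Submodule (polyIn f) (Ω[A⁄ℂ]) where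
  carrier := {ω | ∃ g a : A,
    ω = KaehlerDifferential.D ℂ A g + a • KaehlerDifferential.D ℂ A f}
  zero_mem' := ⟨0, 0, by simp⟩
  add_mem' := by
    rintro _ _ ⟨g, a, rfl⟩ ⟨h, b, rfl⟩
    exact ⟨g + h, a + b, by rw [map_add, add_smul]; abel⟩
  smul_mem' := by
    rintro ⟨p, hp⟩ _ ⟨g, a, rfl⟩
    obtain ⟨q, hq⟩ := exists_D_eq_smul f hp
    refine ⟨p * g, p * a - g * q, ?_⟩
    rw [Derivation.leibniz, hq, sub_smul, mul_smul, mul_smul, Subalgebra.smul_def, smul_add]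
    abel

/-- The first group of truncated relative cohomology
`H¹(f) = Ω¹(X) / (dΩ⁰(X) + Ω⁰(X) df)`, a module over `ℂ[f]`. -/
abbrev H1 (f : A) : Type _ := Ω[A⁄ℂ] ⧸ relExact f

/-- Property `P(y)` of a `ℂ[f]`-module `M`: if `(f - y)^r ω = 0` for some integer `r ≥ 0`, then
`ω ∈ (f - y) M`. -/
def PropertyP (f : A) (M : Type*) [AddCommGroup M] [Module (polyIn f) M] (y : ℂ) : Prop :=
  ∀ (r : ℕ) (ω : M), (gen f - algebraMap ℂ (polyIn f) y) ^ r • ω = 0 →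
    ∃ η : M, ω = (gen f - algebraMap ℂ (polyIn f) y) • η

end RelCohomology

end

/-! ### Prolonging regular sequences by means of Ext; coordinates at a point of affine space -/

namespace RelCohomology
open RingTheory.Sequence CategoryTheory Abelian IsLocalRing
open scoped Pointwise

/-! Write t = f - y and suppose t^(r+1) ω = dg + a dt. On each component of the fibre t = 0 the
function g has zero differential, hence is constant; as the fibre is reduced, some separable p
satisfies t ∣ p(g) (`exists_separable_dvd_aeval`). Newton approximation replaces g by g' = g - t k
with t^(r+2) ∣ p(g'). Differentiating this and inverting p'(g') modulo t^(r+2) puts dg' in t^(r+2)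
Ω¹ + A dt (`exists_sub_D_eq`). Substitution gives t^(r+1) (ω - t η) = t dk + c dt. Then t ∣ c, the
factor t cancels, and induction on r applies to ω - t η (`exists_eq_smul_add_of_pow_smul_eq`).

Three facts are used: A/t is reduced, a dt ∈ t Ω¹ forces t ∣ a, and Ω¹ has no t-torsion. Each
follows from smoothness off finitely many closed points of the fibre and extends across them by
depth (`eq_zero_of_locally_eq_zero`). Indeed the local rings of a complete intersection surface have
depth two, and Ω¹, being the cokernel of an injective Jacobian matrix, has positive depth there
(`exists_regular_pair_localization`). -/

theorem smul_top_quotSMulTop_lt_top {L M : Type*} [CommRing L] [AddCommGroup M] [Module L M]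
    {I : Ideal L} {x : L} (hx : x ∈ I) (hM : I • (⊤ : Submodule L M) < ⊤) :
    I • (⊤ : Submodule L (QuotSMulTop x M)) < ⊤ := by
  refine lt_of_le_of_ne le_top fun eq ↦ hM.ne ?_
  have := congrArg (Submodule.comap (Submodule.mkQ (x • (⊤ : Submodule L M)))) eq
  simpa [Submodule.comap_smul_top_of_surjective I _ (Submodule.mkQ_surjective _),
    Submodule.smul_mono_left ((Ideal.span_singleton_le_iff_mem I).mpr hx),
    ← Submodule.ideal_span_singleton_smul] using this

/-- If `Ext` groups into `M` vanish far enough, a regular sequence on `M` may be prolonged. -/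
theorem exists_isRegular_append_of_ext {L : Type} [CommRing L] [IsNoetherianRing L]
    (I : Ideal L) (N : ModuleCat.{0} L) [Module.Finite L N]
    (hN : Module.support L N = PrimeSpectrum.zeroLocus I) (j : ℕ) (rs : List L) :
    ∀ (M : ModuleCat.{0} L) [Module.Finite L M], I • (⊤ : Submodule L M) < ⊤ →
      (∀ r ∈ rs, r ∈ I) → IsRegular M rs →
      (∀ i < rs.length + j, Subsingleton (Ext N M i)) →
      ∃ rs' : List L, rs'.length = j ∧ (∀ r ∈ rs', r ∈ I) ∧ IsWeaklyRegular M (rs ++ rs') := by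
  induction rs with
  | nil =>
    intro M _ hM _ _ hext
    obtain ⟨rs', h1, h2, h3⟩ := ModuleCat.exists_isRegular_of_exists_subsingleton_ext I j M hM N hN
      (by simpa using hext)
    exact ⟨rs', h1, h2, h3.1⟩
  | cons x rs ih =>
    intro M _ hM hmem hreg hext
    rw [isRegular_cons_iff] at hreg
    have hx : x ∈ I := hmem x (by simp)
    obtain ⟨rs', h1, h2, h3⟩ := ih (ModuleCat.of L (QuotSMulTop x M))
      (smul_top_quotSMulTop_lt_top hx hM)
      (fun r hr ↦ hmem r (by simp [hr])) hreg.2 (fun i hi ↦ by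
        -- In the long exact sequence of 0 → M → M → M/xM → 0, Ext^i into M/xM sits between Ext^i
        -- and Ext^(i+1) into M, so the vanishing range shrinks by exactly one.
        have zero1 := AddCommGrpCat.isZero_of_iff_subsingleton.mpr
          (hext i (by simp only [List.length_cons]; omega))
        have zero2 := AddCommGrpCat.isZero_of_iff_subsingleton.mpr
          (hext (i + 1) (by simp only [List.length_cons]; omega))
        exact AddCommGrpCat.subsingleton_of_isZero <| ShortComplex.Exact.isZero_of_both_zeros
          ((Ext.covariant_sequence_exact₃' N hreg.1.smulShortComplex_shortExact) i (i + 1) rfl)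
          (zero1.eq_zero_of_src _) (zero2.eq_zero_of_tgt _))
    exact ⟨rs', h1, h2, (isWeaklyRegular_cons_iff _ _ _).2 ⟨hreg.1, h3⟩⟩

/-- In a Noetherian local ring with a regular sequence of length `k + j`, every regular sequence of
length `k` may be prolonged by `j` elements. -/
theorem exists_isWeaklyRegular_append {L : Type} [CommRing L] [IsNoetherianRing L] [IsLocalRing L]
    (xs : List L) (hxs : IsRegular L xs) (hxm : ∀ x ∈ xs, x ∈ maximalIdeal L)
    (rs : List L) (hrs : IsRegular L rs) (hrm : ∀ x ∈ rs, x ∈ maximalIdeal L)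
    (j : ℕ) (hj : rs.length + j ≤ xs.length) :
    ∃ rs' : List L, rs'.length = j ∧ (∀ r ∈ rs', r ∈ maximalIdeal L) ∧
      IsWeaklyRegular L (rs ++ rs') := by
  have hlt : maximalIdeal L • (⊤ : Submodule L (ModuleCat.of L L)) < ⊤ := by
    have : maximalIdeal L • (⊤ : Ideal L) < ⊤ := by
      simpa using (maximalIdeal.isMaximal L).ne_top.lt_top
    exact this
  have hs : Module.support L (ModuleCat.of L (L ⧸ maximalIdeal L)) =
      PrimeSpectrum.zeroLocus (maximalIdeal L) := by
    change Module.support L (L ⧸ maximalIdeal L) = _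
    rw [Module.support_eq_zeroLocus, Ideal.annihilator_quotient]
  have : Module.Finite L (ModuleCat.of L (L ⧸ maximalIdeal L)) :=
    inferInstanceAs (Module.Finite L (L ⧸ maximalIdeal L))
  have : Module.Finite L (ModuleCat.of L L) := inferInstanceAs (Module.Finite L L)
  refine exists_isRegular_append_of_ext (maximalIdeal L) _ hs j rs (ModuleCat.of L L) hlt hrm hrs
    fun i hi ↦ ?_
  exact ModuleCat.subsingleton_ext_of_exists_isRegular (maximalIdeal L) _ hs.subset
    (ModuleCat.of L L) hlt xs hxm hxs i (hi.trans_le hj)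

/-- Evaluation of the first `j` variables at `a`. -/
noncomputable def partialEval {n : ℕ} (a : Fin n → ℂ) (j : ℕ) :
    MvPolynomial (Fin n) ℂ →ₐ[ℂ] MvPolynomial (Fin n) ℂ :=
  MvPolynomial.aeval fun i ↦ if (i : ℕ) < j then MvPolynomial.C (a i) else MvPolynomial.X i

theorem sub_partialEval_mem {n : ℕ} (a : Fin n → ℂ) (j : ℕ) (I : Ideal (MvPolynomial (Fin n) ℂ))
    (hI : ∀ i : Fin n, (i : ℕ) < j → MvPolynomial.X i - MvPolynomial.C (a i) ∈ I)
    (p : MvPolynomial (Fin n) ℂ) : p - partialEval a j p ∈ I := by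
  have : (Ideal.Quotient.mkₐ ℂ I).comp (partialEval a j) = Ideal.Quotient.mkₐ ℂ I := by
    refine MvPolynomial.algHom_ext fun i ↦ ?_
    by_cases h : (i : ℕ) < j
    · simpa [partialEval, h] using (Ideal.Quotient.eq.2 (hI i h)).symm
    · simp [partialEval, h]
  exact Ideal.Quotient.eq.1 (congrArg (fun φ ↦ φ p) this).symm

/-- The first j elements generate the kernel of `partialEval a j`, so regularity of the next one is
tested inside a domain. -/
theorem isWeaklyRegular_X_sub_C {n : ℕ} (a : Fin n → ℂ) :
    IsWeaklyRegular (MvPolynomial (Fin n) ℂ)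
      (List.ofFn fun i ↦ MvPolynomial.X i - MvPolynomial.C (a i)) := by
  rw [isWeaklyRegular_iff]
  intro j hj
  have hj' : j < n := by simpa using hj
  have hgen : ∀ i : Fin n, (i : ℕ) < j → MvPolynomial.X i - MvPolynomial.C (a i) ∈
      Ideal.ofList ((List.ofFn fun i ↦ MvPolynomial.X i - MvPolynomial.C (a i)).take j) := by
    intro i hi
    refine Ideal.subset_span ?_
    refine List.mem_iff_getElem.2 ⟨i, by simp [hi], by simp⟩
  have hker : Ideal.ofList ((List.ofFn fun i ↦ MvPolynomial.X i - MvPolynomial.C (a i)).take j)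
      = RingHom.ker (partialEval a j).toRingHom := by
    refine le_antisymm (Ideal.span_le.2 ?_) fun p hp ↦ ?_
    · intro x hx
      obtain ⟨i, hi, rfl⟩ := List.mem_iff_getElem.1 (show x ∈ List.take j _ from hx)
      have hi' : i < j ∧ i < n := by simpa using hi
      simp [partialEval, RingHom.mem_ker, hi'.1]
    · have := sub_partialEval_mem a j _ hgen p
      rwa [show partialEval a j p = 0 from hp, sub_zero] at this
  rw [isSMulRegular_iff_right_eq_zero_of_smul]
  intro x hx
  obtain ⟨p, rfl⟩ := Submodule.Quotient.mk_surjective _ x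
  rw [← Submodule.Quotient.mk_smul, Submodule.Quotient.mk_eq_zero] at hx
  rw [Submodule.Quotient.mk_eq_zero]
  simp only [smul_eq_mul, Ideal.mul_top, hker, RingHom.mem_ker, List.getElem_ofFn] at hx ⊢
  have h2 : (MvPolynomial.X (⟨j, hj'⟩ : Fin n) - MvPolynomial.C (a ⟨j, hj'⟩)) *
      partialEval a j p = 0 := by
    simpa [partialEval] using hx
  refine (mul_eq_zero.1 h2).resolve_left fun h ↦ ?_
  have := congrArg (MvPolynomial.eval fun _ ↦ a ⟨j, hj'⟩ + 1) h
  simp at this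

end RelCohomology

/-! ### Dimension of the local rings at closed points -/

namespace RelCohomology
open RingTheory.Sequence IsLocalRing

theorem exists_isRegular_localization_of_isMaximal {n : ℕ} (q : Ideal (MvPolynomial (Fin n) ℂ))
    [hq : q.IsMaximal] : ∃ xs : List (Localization.AtPrime q), xs.length = n ∧
      IsRegular (Localization.AtPrime q) xs ∧ ∀ x ∈ xs, x ∈ maximalIdeal _ := by
  obtain ⟨a, rfl⟩ := MvPolynomial.isMaximal_iff_eq_vanishingIdeal_singleton.1 hq
  have hmem : ∀ r ∈ (List.ofFn fun i ↦ (MvPolynomial.X i - MvPolynomial.C (a i) :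
      MvPolynomial (Fin n) ℂ)), r ∈ MvPolynomial.vanishingIdeal ℂ {a} := by
    intro r hr
    obtain ⟨i, rfl⟩ := (List.mem_ofFn' _ _).1 hr
    simp
  refine ⟨_, ?_, (isWeaklyRegular_X_sub_C a).isRegular_of_isLocalization_of_mem _
    (MvPolynomial.vanishingIdeal ℂ {a}) hmem, ?_⟩
  · simp
  · intro x hx
    obtain ⟨r, hr, rfl⟩ := List.mem_map.1 hx
    exact (IsLocalization.AtPrime.to_map_mem_maximal_iff _ _ _).2 (hmem r hr)

theorem ringKrullDim_localization_of_isMaximal {n : ℕ} (q : Ideal (MvPolynomial (Fin n) ℂ))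
    [hq : q.IsMaximal] : ringKrullDim (Localization.AtPrime q) = n := by
  refine le_antisymm ?_ ?_
  · rw [IsLocalization.AtPrime.ringKrullDim_eq_height q]
    refine (Ideal.height_le_ringKrullDim_of_ne_top hq.ne_top).trans ?_
    simp [MvPolynomial.ringKrullDim_of_isNoetherianRing]
  · obtain ⟨xs, hlen, hreg, hmem⟩ := exists_isRegular_localization_of_isMaximal q
    rw [← ringKrullDim_add_length_eq_ringKrullDim_of_isRegular xs hreg, hlen]
    have : Nontrivial (Localization.AtPrime q ⧸ Ideal.ofList xs) := by
      refine Ideal.Quotient.nontrivial_iff.2 (ne_top_of_le_ne_top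
        (maximalIdeal.isMaximal _).ne_top (Ideal.span_le.2 hmem))
    exact le_add_of_nonneg_left ringKrullDim_nonneg_of_nontrivial

theorem height_eq_of_isMaximal {n : ℕ} (q : Ideal (MvPolynomial (Fin n) ℂ))
    [hq : q.IsMaximal] : q.height = n := by
  have := ringKrullDim_localization_of_isMaximal q
  rw [IsLocalization.AtPrime.ringKrullDim_eq_height q] at this
  exact_mod_cast this

variable {A : Type*} [CommRing A] [IsDomain A] [Algebra ℂ A]

/-- Going down over the normal polynomial ring bounds every maximal height from below, and
incomparability bounds the dimension from above. Hence all closed points of A have the same height.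
-/
theorem height_eq_of_isIntegral {s : ℕ} [Algebra.FiniteType ℂ A]
    (φ : MvPolynomial (Fin s) ℂ →ₐ[ℂ] A)
    (hinj : Function.Injective φ) (hint : φ.toRingHom.IsIntegral) (m : Ideal A) [m.IsMaximal] :
    (s : WithBot ℕ∞) ≤ m.height ∧ ringKrullDim A ≤ s := by
  algebraize [φ.toRingHom]
  have : Algebra.IsIntegral (MvPolynomial (Fin s) ℂ) A := ⟨hint⟩
  have : FaithfulSMul (MvPolynomial (Fin s) ℂ) A :=
    (faithfulSMul_iff_algebraMap_injective _ _).2 hinj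
  have : IsNoetherianRing A := Algebra.FiniteType.isNoetherianRing ℂ A
  constructor
  · have : (m.under (MvPolynomial (Fin s) ℂ)).IsMaximal :=
      Ideal.isMaximal_comap_of_isIntegral_of_isMaximal m
    have h := Ideal.height_eq_height_add_of_liesOver_of_hasGoingDown
      (m.under (MvPolynomial (Fin s) ℂ)) m
    rw [height_eq_of_isMaximal] at h
    rw [h]
    exact_mod_cast le_self_add
  · refine (Order.krullDim_le_of_strictMono
      (PrimeSpectrum.comap (algebraMap (MvPolynomial (Fin s) ℂ) A)) ?_).trans_eq
      (show ringKrullDim (MvPolynomial (Fin s) ℂ) = s by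
        simp [MvPolynomial.ringKrullDim_of_isNoetherianRing])
    intro P Q h
    exact Ideal.IsIntegral.comap_lt_comap (R := MvPolynomial (Fin s) ℂ)
      (show P.asIdeal < Q.asIdeal from h)

theorem exists_normalization [Algebra.FiniteType ℂ A] (hdim : ringKrullDim A = 2) :
    ∃ φ : MvPolynomial (Fin 2) ℂ →ₐ[ℂ] A, Function.Injective φ ∧ φ.toRingHom.IsIntegral := by
  obtain ⟨s, φ, hinj, hint⟩ := exists_integral_inj_algHom_of_fg ℂ A
  obtain ⟨m, hm⟩ := Ideal.exists_maximal A
  obtain ⟨h1, h2⟩ := height_eq_of_isIntegral φ hinj hint m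
  have h3 := h1.trans (Ideal.height_le_ringKrullDim_of_ne_top hm.ne_top)
  rw [hdim] at h2 h3
  obtain rfl : s = 2 := le_antisymm (by exact_mod_cast h3) (by exact_mod_cast h2)
  exact ⟨φ, hinj, hint⟩

theorem ringKrullDim_localization_eq_two [Algebra.FiniteType ℂ A] (hdim : ringKrullDim A = 2)
    (m : Ideal A) [hm : m.IsMaximal] : ringKrullDim (Localization.AtPrime m) = 2 := by
  obtain ⟨φ, hinj, hint⟩ := exists_normalization hdim
  rw [IsLocalization.AtPrime.ringKrullDim_eq_height m]
  exact le_antisymm (hdim ▸ Ideal.height_le_ringKrullDim_of_ne_top hm.ne_top)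
    (height_eq_of_isIntegral φ hinj hint m).1

end RelCohomology

/-! ### Depth two for quotients by a regular sequence -/

namespace RelCohomology
open RingTheory.Sequence IsLocalRing

theorem localRingHom_surjective {R S : Type*} [CommRing R] [CommRing S] (π : R →+* S)
    (hπ : Function.Surjective π) (p : Ideal S) [p.IsPrime] :
    Function.Surjective (Localization.localRingHom (p.comap π) p π rfl) := by
  intro z
  obtain ⟨a, s, rfl⟩ := IsLocalization.exists_mk'_eq p.primeCompl z
  obtain ⟨a', rfl⟩ := hπ a
  obtain ⟨s', hs'⟩ := hπ s
  refine ⟨IsLocalization.mk' _ a' (⟨s', fun h ↦ s.2 (by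
    rw [← hs']; exact h)⟩ : (p.comap π).primeCompl), ?_⟩
  rw [Localization.localRingHom_mk']
  congr 1
  exact Subtype.ext hs'

theorem ker_localRingHom {R S : Type*} [CommRing R] [CommRing S] (π : R →+* S)
    (hπ : Function.Surjective π) (p : Ideal S) [p.IsPrime] :
    RingHom.ker (Localization.localRingHom (p.comap π) p π rfl) =
      (RingHom.ker π).map (algebraMap R (Localization.AtPrime (p.comap π))) := by
  refine le_antisymm (fun z hz ↦ ?_) (Ideal.map_le_iff_le_comap.2 fun z hz ↦ ?_)
  · obtain ⟨a, s, rfl⟩ := IsLocalization.exists_mk'_eq (p.comap π).primeCompl z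
    rw [RingHom.mem_ker, Localization.localRingHom_mk', IsLocalization.mk'_eq_zero_iff] at hz
    obtain ⟨⟨c, hc⟩, h⟩ := hz
    obtain ⟨c', rfl⟩ := hπ c
    have h2 : c' * a ∈ RingHom.ker π := by rw [RingHom.mem_ker, map_mul]; exact h
    rw [IsLocalization.mk'_mem_map_algebraMap_iff]
    exact ⟨c', hc, h2⟩
  · rw [Ideal.mem_comap, RingHom.mem_ker, Localization.localRingHom_to_map,
      RingHom.mem_ker.1 hz, map_zero]

/-- The sequence `rs` is prolonged by two elements a, b. Modulo `rs` this says that a is a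
nonzerodivisor on S and b is one on S/a. -/
theorem exists_regular_pair {L : Type} {S : Type*} [CommRing L] [IsNoetherianRing L]
    [IsLocalRing L] [CommRing S] (ψ : L →+* S) (hψ : Function.Surjective ψ) (rs xs : List L)
    (hrs : IsRegular L rs) (hker : RingHom.ker ψ = Ideal.ofList rs)
    (hxs : IsRegular L xs) (hxm : ∀ x ∈ xs, x ∈ maximalIdeal L)
    (hlen : rs.length + 2 ≤ xs.length) :
    ∃ a b : L, a ∈ maximalIdeal L ∧ b ∈ maximalIdeal L ∧ (∀ w, ψ a * w = 0 → w = 0) ∧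
      ∀ w, ψ a ∣ ψ b * w → ψ a ∣ w := by
  have hrm : ∀ x ∈ rs, x ∈ maximalIdeal L := by
    have h1 : Ideal.ofList rs ≠ ⊤ := fun h ↦ hrs.2 (by simp [h])
    exact fun x hx ↦ le_maximalIdeal h1 (Ideal.subset_span hx)
  obtain ⟨rs', hl, hm, hreg⟩ := exists_isWeaklyRegular_append xs hxs hxm rs hrs hrm 2 hlen
  obtain ⟨a, b, rfl⟩ := List.length_eq_two.1 hl
  rw [isWeaklyRegular_iff] at hreg
  have ha := hreg rs.length (by simp)
  have hb := hreg (rs.length + 1) (by simp)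
  rw [isSMulRegular_iff_right_eq_zero_of_smul] at ha hb
  refine ⟨a, b, hm a (by simp), hm b (by simp), fun w hw ↦ ?_, fun w hw ↦ ?_⟩
  · obtain ⟨w, rfl⟩ := hψ w
    have := ha (Submodule.Quotient.mk w)
    rw [← Submodule.Quotient.mk_smul, Submodule.Quotient.mk_eq_zero,
      Submodule.Quotient.mk_eq_zero] at this
    simp only [List.take_left, List.getElem_append_right le_rfl, smul_eq_mul, Ideal.mul_top,
      ← hker, RingHom.mem_ker, map_mul] at this
    exact this (by simpa using hw)
  · obtain ⟨w, rfl⟩ := hψ w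
    obtain ⟨c, hc⟩ := hw
    obtain ⟨c, rfl⟩ := hψ c
    have := hb (Submodule.Quotient.mk w)
    rw [← Submodule.Quotient.mk_smul, Submodule.Quotient.mk_eq_zero,
      Submodule.Quotient.mk_eq_zero] at this
    have htake : List.take (rs.length + 1) (rs ++ [a, b]) = rs ++ [a] := by
      simp [List.take_append]
    simp only [htake, smul_eq_mul, Ideal.mul_top, Ideal.ofList_append, ← hker,
      Ideal.ofList_singleton] at this
    have hmem : b * w ∈ RingHom.ker ψ ⊔ Ideal.span {a} := by
      rw [show b * w = (b * w - a * c) + a * c by ring]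
      refine Submodule.add_mem_sup ?_ (Ideal.mul_mem_right _ _ (Ideal.mem_span_singleton_self a))
      rw [RingHom.mem_ker, map_sub, map_mul, map_mul, hc, sub_self]
    obtain ⟨u, hu, v, hv, huv⟩ := Submodule.mem_sup.1 (this (by simpa using hmem))
    obtain ⟨d, rfl⟩ := Ideal.mem_span_singleton'.1 hv
    exact ⟨ψ d, by rw [← huv, map_add, RingHom.mem_ker.1 hu, zero_add, map_mul, mul_comm]⟩

end RelCohomology

/-! ### Differentials of a complete intersection -/

namespace RelCohomology
open RingTheory.Sequence IsLocalRing
open scoped TensorProduct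

section Modules
variable {S F : Type*} [CommRing S] [IsDomain S] [AddCommGroup F] [Module S F]

/-- If the quotient of a free module of rank `k + 2` by `k` vectors has rank at most `2`, these
vectors are linearly independent. -/
theorem linearIndependent_of_finrank_quotient_le [IsNoetherianRing S] [Module.Finite S F]
    [Module.Free S F] {k : ℕ} (v : Fin k → F) (hF : Module.finrank S F = k + 2)
    (hq : Module.finrank S (F ⧸ Submodule.span S (Set.range v)) ≤ 2) :
    LinearIndependent S v := by
  have h1 := Submodule.finrank_quotient_add_finrank (Submodule.span S (Set.range v))
  set T := Fintype.linearCombination S v with hT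
  have hr : T.range = Submodule.span S (Set.range v) := Fintype.range_linearCombination S v
  have h2 := Submodule.finrank_quotient_add_finrank T.ker
  have h3 : Module.finrank S ((Fin k → S) ⧸ T.ker) = Module.finrank S T.range :=
    T.quotKerEquivRange.finrank_eq
  rw [h3, hr, Module.finrank_fin_fun] at h2
  -- The span has rank at least (k + 2) - 2 = k, which leaves rank 0 for the relations among the k
  -- vectors.
  have h4 : Module.finrank S T.ker = 0 := by omega
  rw [Submodule.finrank_eq_zero] at h4
  refine Fintype.linearIndependent_iff.2 fun g hg i ↦ ?_
  have h5 : g ∈ T.ker := by rw [LinearMap.mem_ker, hT, Fintype.linearCombination_apply, hg]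
  rw [h4, Submodule.mem_bot] at h5
  exact congrFun h5 i

/-- If a x = ∑ cᵢ vᵢ and b x = ∑ dᵢ vᵢ, independence gives b cᵢ = a dᵢ, so a divides each cᵢ and can
be cancelled. This is positive depth of the cokernel of v. -/
theorem mem_span_of_smul_mem_span [Module.IsTorsionFree S F] {k : ℕ} {v : Fin k → F}
    (hv : LinearIndependent S v) {a b : S} (ha : a ≠ 0) (hab : ∀ w, a ∣ b * w → a ∣ w) {x : F}
    (hax : a • x ∈ Submodule.span S (Set.range v)) (hbx : b • x ∈ Submodule.span S (Set.range v)) :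
    x ∈ Submodule.span S (Set.range v) := by
  obtain ⟨c, hc⟩ := (Submodule.mem_span_range_iff_exists_fun S).1 hax
  obtain ⟨d, hd⟩ := (Submodule.mem_span_range_iff_exists_fun S).1 hbx
  have h0 : ∑ i, (b * c i - a * d i) • v i = 0 := by
    simp only [sub_smul, mul_smul, Finset.sum_sub_distrib, ← Finset.smul_sum, hc, hd]
    rw [smul_comm, sub_self]
  have h1 : ∀ i, a ∣ c i := fun i ↦ hab _ ⟨d i, sub_eq_zero.1
    (Fintype.linearIndependent_iff.1 hv _ h0 i)⟩
  choose e he using h1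
  have h2 : a • (x - ∑ i, e i • v i) = 0 := by
    rw [smul_sub, ← hc, Finset.smul_sum]
    simp [he, mul_smul]
  have h3 := (smul_eq_zero.1 h2).resolve_left ha
  rw [sub_eq_zero.1 h3]
  exact Submodule.sum_mem _ fun i _ ↦ Submodule.smul_mem _ _ (Submodule.subset_span ⟨i, rfl⟩)

end Modules

/-- A complete intersection quotient of a ring with free differentials: a differential killed by
a regular pair vanishes. -/
theorem kaehler_eq_zero_of_smul_eq_zero {L : Type*} {S : Type*} [CommRing L] [Algebra ℂ L]
    [CommRing S] [IsDomain S] [IsNoetherianRing S] [Algebra ℂ S] [Algebra L S]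
    [IsScalarTower ℂ L S] (hsurj : Function.Surjective (algebraMap L S)) (rs : List L)
    (hker : RingHom.ker (algebraMap L S) = Ideal.ofList rs)
    [Module.Free L Ω[L⁄ℂ]] [Module.Finite L Ω[L⁄ℂ]] [Nontrivial L]
    (hrank : Module.finrank L Ω[L⁄ℂ] = rs.length + 2) (hS : Module.finrank S Ω[S⁄ℂ] ≤ 2)
    {a b : S} (ha : a ≠ 0) (hab : ∀ w, a ∣ b * w → a ∣ w) (ω : Ω[S⁄ℂ])
    (haω : a • ω = 0) (hbω : b • ω = 0) : ω = 0 := by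
  let v : Fin rs.length → S ⊗[L] Ω[L⁄ℂ] := fun i ↦ 1 ⊗ₜ KaehlerDifferential.D ℂ L rs[i]
  let T := KaehlerDifferential.mapBaseChange ℂ L S
  have hT : Function.Surjective T := KaehlerDifferential.mapBaseChange_surjective ℂ L S hsurj
  have hkerT : T.ker = Submodule.span S (Set.range v) := by
    refine le_antisymm (fun z hz ↦ ?_) (Submodule.span_le.2 ?_)
    · obtain ⟨c, rfl⟩ := (KaehlerDifferential.exact_kerCotangentToTensor_mapBaseChange
        ℂ L S hsurj z).1 hz
      obtain ⟨⟨c, hc⟩, rfl⟩ := Ideal.toCotangent_surjective _ c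
      rw [KaehlerDifferential.kerCotangentToTensor_toCotangent]
      have hc' : c ∈ Ideal.span {r | r ∈ rs} := by rw [hker] at hc; exact hc
      -- Membership in the kernel is carried through the induction: in d(l x) = l dx + x dl the last
      -- term dies only because x maps to 0 in S.
      have hkey : (1 : S) ⊗ₜ[L] KaehlerDifferential.D ℂ L c ∈ Submodule.span S (Set.range v) ∧
          c ∈ RingHom.ker (algebraMap L S) := by
        clear hz hc
        induction hc' using Submodule.span_induction with
        | mem x hx =>
          obtain ⟨i, hi, rfl⟩ := List.mem_iff_getElem.1 hx
          exact ⟨Submodule.subset_span ⟨⟨i, hi⟩, rfl⟩, by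
            rw [hker]; exact Ideal.subset_span hx⟩
        | zero => simp
        | add x y _ _ hx hy =>
          rw [map_add, TensorProduct.tmul_add]
          exact ⟨add_mem hx.1 hy.1, add_mem hx.2 hy.2⟩
        | smul l x _ hx =>
          refine ⟨?_, Ideal.mul_mem_left _ _ hx.2⟩
          rw [smul_eq_mul, Derivation.leibniz, TensorProduct.tmul_add, TensorProduct.tmul_smul,
            TensorProduct.tmul_smul]
          refine add_mem ?_ ?_
          · rw [← algebraMap_smul S l]
            exact Submodule.smul_mem _ _ hx.1
          · rw [← algebraMap_smul S x, RingHom.mem_ker.1 hx.2, zero_smul]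
            exact zero_mem _
      exact hkey.1
    · rintro _ ⟨i, rfl⟩
      have h0 : algebraMap L S rs[(i : ℕ)] = 0 := by
        rw [← RingHom.mem_ker, hker]
        exact Ideal.subset_span (List.getElem_mem _)
      simp [T, v, h0]
  have hquot : Module.finrank S ((S ⊗[L] Ω[L⁄ℂ]) ⧸ Submodule.span S (Set.range v)) ≤ 2 := by
    rw [← hkerT]
    exact (T.quotKerEquivOfSurjective hT).finrank_eq.trans_le hS
  have hv := linearIndependent_of_finrank_quotient_le v
    (by rw [Module.finrank_baseChange, hrank]) hquot
  obtain ⟨x, rfl⟩ := hT ω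
  rw [← LinearMap.mem_ker, hkerT]
  refine mem_span_of_smul_mem_span hv ha hab ?_ ?_
  · rw [← hkerT, LinearMap.mem_ker, map_smul]; exact haω
  · rw [← hkerT, LinearMap.mem_ker, map_smul]; exact hbω

/-- In characteristic zero K is separable over the fraction field of the polynomial ring, so the
relative differentials vanish and dx₁, …, dxₛ span. -/
theorem finrank_kaehler_le_of_isAlgebraic {s : ℕ} (K : Type*) [Field K] [Algebra ℂ K]
    [Algebra (MvPolynomial (Fin s) ℂ) K] [IsScalarTower ℂ (MvPolynomial (Fin s) ℂ) K]
    [FaithfulSMul (MvPolynomial (Fin s) ℂ) K] [Algebra.IsAlgebraic (MvPolynomial (Fin s) ℂ) K] :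
    Module.finrank K Ω[K⁄ℂ] ≤ s := by
  let U := MvPolynomial (Fin s) ℂ
  let := FractionRing.liftAlgebra U K
  have := FractionRing.isScalarTower_liftAlgebra U K
  have : Algebra.IsAlgebraic (FractionRing U) K :=
    (IsFractionRing.comap_isAlgebraic_iff (A := U)).1 inferInstance
  have : CharZero (FractionRing U) := IsFractionRing.charZero U
  have : Algebra.FormallyUnramified (FractionRing U) K := .of_isSeparable _ _
  have : Algebra.FormallyUnramified U (FractionRing U) := .of_isLocalization (nonZeroDivisors U)
  have : Algebra.FormallyUnramified U K := .comp U (FractionRing U) K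
  have hsurj : Function.Surjective (KaehlerDifferential.mapBaseChange ℂ U K) := by
    rw [← LinearMap.range_eq_top, KaehlerDifferential.range_mapBaseChange, ← top_le_iff]
    exact fun x _ ↦ Subsingleton.elim _ _
  have hb := KaehlerDifferential.mvPolynomialBasis ℂ (Fin s)
  have : Module.Free U Ω[U⁄ℂ] := .of_basis hb
  have : Module.Finite U Ω[U⁄ℂ] := .of_basis hb
  refine (LinearMap.finrank_le_finrank_of_surjective hsurj).trans_eq ?_
  rw [Module.finrank_baseChange, Module.finrank_eq_card_basis hb, Fintype.card_fin]

variable {A : Type*} [CommRing A] [IsDomain A] [Algebra ℂ A] [Algebra.FiniteType ℂ A]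

theorem finrank_kaehler_le_two (hdim : ringKrullDim A = 2) : Module.finrank A Ω[A⁄ℂ] ≤ 2 := by
  obtain ⟨φ, hinj, hint⟩ := exists_normalization hdim
  let U := MvPolynomial (Fin 2) ℂ
  let K := FractionRing A
  let : Algebra U A := φ.toRingHom.toAlgebra
  have : IsScalarTower ℂ U A := .of_algHom φ
  have : Algebra.IsIntegral U A := ⟨hint⟩
  have : FaithfulSMul U A := (faithfulSMul_iff_algebraMap_injective _ _).2 hinj
  have : Algebra.IsAlgebraic U K :=
    (IsFractionRing.isAlgebraic_iff' U A K).1 inferInstance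
  have : FaithfulSMul U K := (faithfulSMul_iff_algebraMap_injective _ _).2 <| by
    rw [IsScalarTower.algebraMap_eq U A K]
    exact (IsFractionRing.injective A K).comp hinj
  have h := finrank_kaehler_le_of_isAlgebraic (s := 2) K
  rwa [Module.finrank, IsLocalization.rank_eq K (nonZeroDivisors A) le_rfl, ← Module.finrank,
    IsLocalizedModule.finrank_eq (nonZeroDivisors A) (KaehlerDifferential.map ℂ ℂ A K) le_rfl] at h

theorem finrank_kaehler_localization_le_two (hdim : ringKrullDim A = 2) (m : Ideal A) [m.IsPrime] :
    Module.finrank (Localization.AtPrime m) Ω[Localization.AtPrime m⁄ℂ] ≤ 2 := by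
  have hm : m.primeCompl ≤ nonZeroDivisors A := m.primeCompl_le_nonZeroDivisors
  rw [Module.finrank, IsLocalization.rank_eq (Localization.AtPrime m) m.primeCompl hm,
    ← Module.finrank, IsLocalizedModule.finrank_eq m.primeCompl
      (KaehlerDifferential.map ℂ ℂ A (Localization.AtPrime m)) hm]
  exact finrank_kaehler_le_two hdim

theorem finrank_kaehler_localization_mvPolynomial {n : ℕ} (q : Ideal (MvPolynomial (Fin n) ℂ))
    [q.IsPrime] :
    Module.Free (Localization.AtPrime q) Ω[Localization.AtPrime q⁄ℂ] ∧
    Module.Finite (Localization.AtPrime q) Ω[Localization.AtPrime q⁄ℂ] ∧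
    Module.finrank (Localization.AtPrime q) Ω[Localization.AtPrime q⁄ℂ] = n := by
  have hb := KaehlerDifferential.mvPolynomialBasis ℂ (Fin n)
  have : Module.Free _ Ω[MvPolynomial (Fin n) ℂ⁄ℂ] := .of_basis hb
  have : Module.Finite _ Ω[MvPolynomial (Fin n) ℂ⁄ℂ] := .of_basis hb
  have : Algebra.FormallyEtale (MvPolynomial (Fin n) ℂ) (Localization.AtPrime q) :=
    .of_isLocalization q.primeCompl
  have e := KaehlerDifferential.tensorKaehlerEquivOfFormallyEtale ℂ (MvPolynomial (Fin n) ℂ)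
    (Localization.AtPrime q)
  refine ⟨.of_equiv e, .equiv e, ?_⟩
  rw [← e.finrank_eq, Module.finrank_baseChange, Module.finrank_eq_card_basis hb, Fintype.card_fin]

/-- The local rings at closed points of a locally complete intersection surface have depth two,
and their modules of differentials have positive depth. -/
theorem exists_regular_pair_localization (hdim : ringKrullDim A = 2)
    (hlci : IsLocallyCompleteIntersection A) (m : Ideal A) [hm : m.IsMaximal] :
    ∃ a b : Localization.AtPrime m, a ∈ maximalIdeal (Localization.AtPrime m) ∧
      b ∈ maximalIdeal (Localization.AtPrime m) ∧ a ≠ 0 ∧ (∀ w, a ∣ b * w → a ∣ w) ∧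
      ∀ ω : Ω[Localization.AtPrime m⁄ℂ], a • ω = 0 → b • ω = 0 → ω = 0 := by
  obtain ⟨n, π, hπ, H⟩ := hlci
  obtain ⟨rs, hrs, hgen⟩ := H ⟨m, hm⟩
  change List (Localization.AtPrime (m.comap π.toRingHom)) at rs
  let q := m.comap π.toRingHom
  have : q.IsMaximal := Ideal.comap_isMaximal_of_surjective π.toRingHom hπ
  let ψ := Localization.localRingHom q m π.toRingHom rfl
  have hψ : Function.Surjective ψ := localRingHom_surjective π.toRingHom hπ m
  have hker : RingHom.ker ψ = Ideal.ofList rs := by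
    rw [ker_localRingHom π.toRingHom hπ m]; exact hgen.symm
  obtain ⟨xs, hlen, hreg, hmem⟩ := exists_isRegular_localization_of_isMaximal q
  have hk : rs.length + 2 = n := by
    have h1 := ringKrullDim_add_length_eq_ringKrullDim_of_isRegular rs hrs
    have h2 : ringKrullDim (Localization.AtPrime q ⧸ Ideal.ofList rs) = 2 := by
      rw [← hker, ringKrullDim_eq_of_ringEquiv (RingHom.quotientKerEquivOfSurjective hψ)]
      exact ringKrullDim_localization_eq_two hdim m
    have h3 : ringKrullDim (Localization.AtPrime q) = n :=
      ringKrullDim_localization_of_isMaximal q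
    have h4 : ((2 : ℕ) : WithBot ℕ∞) + (rs.length : ℕ) = (n : ℕ) := by
      rw [← h3, ← h1]; exact congrArg (· + _) h2.symm
    have h5 : 2 + rs.length = n := by exact_mod_cast h4
    omega
  obtain ⟨a, b, ha, hb, ha0, hab⟩ := exists_regular_pair ψ hψ rs xs hrs hker hreg hmem
    (by rw [hlen, hk])
  have hloc : IsLocalHom ψ := Localization.isLocalHom_localRingHom _ _ _ _
  have hψm : ∀ x ∈ maximalIdeal (Localization.AtPrime q),
      ψ x ∈ maximalIdeal (Localization.AtPrime m) := fun x hx ↦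
    (map_mem_nonunits_iff ψ x).2 hx
  have ha1 : ψ a ≠ 0 := fun h ↦ one_ne_zero (ha0 1 (by rw [h, zero_mul]))
  refine ⟨ψ a, ψ b, hψm a ha, hψm b hb, ha1, hab, fun ω h1 h2 ↦ ?_⟩
  let : Algebra (Localization.AtPrime q) (Localization.AtPrime m) := ψ.toAlgebra
  have : IsScalarTower ℂ (Localization.AtPrime q) (Localization.AtPrime m) := by
    refine .of_algebraMap_eq fun c ↦ ?_
    change _ = ψ _
    rw [IsScalarTower.algebraMap_apply ℂ (MvPolynomial (Fin n) ℂ) (Localization.AtPrime q),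
      Localization.localRingHom_to_map, IsScalarTower.algebraMap_apply ℂ A]
    exact congrArg _ (π.commutes c).symm
  obtain ⟨hfree, hfin, hrank⟩ := finrank_kaehler_localization_mvPolynomial q
  have : IsNoetherianRing A := Algebra.FiniteType.isNoetherianRing ℂ A
  have : IsNoetherianRing (Localization.AtPrime m) :=
    IsLocalization.isNoetherianRing m.primeCompl _ inferInstance
  exact kaehler_eq_zero_of_smul_eq_zero hψ rs hker (hrank.trans hk.symm)
    (finrank_kaehler_localization_le_two hdim m) ha1 hab ω h1 h2

end RelCohomology

/-! ### From local to global, ignoring finitely many closed points -/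

namespace RelCohomology
open IsLocalRing

section Support
variable {A : Type*} [CommRing A]

/-- In a Jacobson ring p is the intersection of the maximal ideals above it. When these are finitely
many, the prime p contains one of them. -/
theorem isMaximal_of_forall_maximal_mem_finite [IsJacobsonRing A] {E : Set (MaximalSpectrum A)}
    (hE : E.Finite) {p : Ideal A} (hp : p.IsPrime)
    (h : ∀ m : MaximalSpectrum A, p ≤ m.asIdeal → m ∈ E) : p.IsMaximal := by
  classical
  have hjac := isJacobsonRing_iff_prime_eq.1 inferInstance p hp
  have hle : (hE.toFinset.filter fun m ↦ p ≤ m.asIdeal).inf MaximalSpectrum.asIdeal ≤ p := by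
    intro x hx
    rw [← hjac]
    refine Ideal.mem_sInf.2 fun {J} hJ ↦ ?_
    exact Finset.inf_le (f := MaximalSpectrum.asIdeal) (b := ⟨J, hJ.2⟩)
      (by simpa using ⟨h ⟨J, hJ.2⟩ hJ.1, hJ.1⟩) hx
  obtain ⟨m, hm, hmp⟩ := hp.inf_le'.1 hle
  rw [le_antisymm (Finset.mem_filter.1 hm).2 hmp]
  exact m.isMaximal

/-- An element of a module without closed embedded points vanishes as soon as it vanishes outside
finitely many closed points. -/
theorem eq_zero_of_locally_eq_zero [IsJacobsonRing A] [IsNoetherianRing A] {N : Type*}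
    [AddCommGroup N] [Module A N]
    (hN : ∀ m : Ideal A, m.IsMaximal → ∀ w : N, (∀ x ∈ m, x • w = 0) → ∃ s ∉ m, s • w = 0)
    {E : Set (MaximalSpectrum A)} (hE : E.Finite) (z : N)
    (hz : ∀ m : MaximalSpectrum A, m ∉ E → ∃ s ∉ m.asIdeal, s • z = 0) : z = 0 := by
  by_contra hne
  obtain ⟨P, hP, hle⟩ := exists_le_isAssociatedPrime_of_isNoetherianRing A z hne
  obtain ⟨hprime, w, hw⟩ := isAssociatedPrime_iff.1 hP
  have hmax : P.IsMaximal := by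
    refine isMaximal_of_forall_maximal_mem_finite hE hprime fun m hm ↦ ?_
    by_contra hmE
    obtain ⟨s, hs, hsz⟩ := hz m hmE
    exact hs (hm (hle (by simpa [Submodule.mem_colon_singleton] using hsz)))
  have hmem : ∀ x, x ∈ P ↔ x • w = 0 := fun x ↦ by
    rw [hw]; simp [Submodule.mem_colon_singleton]
  obtain ⟨s, hs, hsw⟩ := hN P hmax w fun x hx ↦ (hmem x).1 hx
  exact hs ((hmem s).2 hsw)

theorem exists_smul_dvd_of_dvd_localization {m : Ideal A} [m.IsPrime] {t z : A}
    (h : algebraMap A (Localization.AtPrime m) t ∣ algebraMap A (Localization.AtPrime m) z) :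
    ∃ s ∉ m, t ∣ s * z := by
  obtain ⟨c, hc⟩ := h
  obtain ⟨a, s, rfl⟩ := IsLocalization.exists_mk'_eq m.primeCompl c
  have h1 : algebraMap A (Localization.AtPrime m) (s * z) =
      algebraMap A (Localization.AtPrime m) (t * a) := by
    rw [map_mul, hc, map_mul, mul_left_comm, IsLocalization.mk'_spec']
  obtain ⟨u, hu⟩ := (IsLocalization.eq_iff_exists m.primeCompl _).1 h1
  exact ⟨u * s, m.primeCompl.mul_mem u.2 s.2, u * a, by rw [mul_assoc, hu]; ring⟩

end Support

section Smooth
variable {A : Type*} [CommRing A] [Algebra ℂ A] [Algebra.FiniteType ℂ A]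

/-- At a smooth closed point where `dt` does not vanish, some local derivation maps `t` to `1`. -/
theorem exists_linearMap_D_eq_one (m : Ideal A) [hm : m.IsMaximal] (hsm : Algebra.IsSmoothAt ℂ m)
    (t : A) (ht : KaehlerDifferential.D ℂ A t ∉ m • (⊤ : Submodule A Ω[A⁄ℂ])) :
    ∃ φ : Ω[Localization.AtPrime m⁄ℂ] →ₗ[Localization.AtPrime m] Localization.AtPrime m,
      φ (KaehlerDifferential.D ℂ _ (algebraMap A _ t)) = 1 := by
  set S := Localization.AtPrime m with hS
  have : Algebra.FormallySmooth ℂ S := hsm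
  have : Module.Free S Ω[S⁄ℂ] := Module.free_of_flat_of_isLocalRing
  let β := Module.Free.chooseBasis S Ω[S⁄ℂ]
  let f := KaehlerDifferential.map ℂ ℂ A S
  have hf : f (KaehlerDifferential.D ℂ A t) = KaehlerDifferential.D ℂ S (algebraMap A S t) :=
    KaehlerDifferential.map_D _ _ _ _ _
  by_cases hall : ∀ i, β.repr (KaehlerDifferential.D ℂ S (algebraMap A S t)) i ∈ maximalIdeal S
  · exfalso
    have hmem : f (KaehlerDifferential.D ℂ A t) ∈
        maximalIdeal S • (⊤ : Submodule S Ω[S⁄ℂ]) := by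
      rw [hf, ← β.sum_repr (KaehlerDifferential.D ℂ S (algebraMap A S t))]
      exact Submodule.sum_mem _ fun i _ ↦ Submodule.smul_mem_smul (hall i) trivial
    -- Clearing denominators brings dt from 𝔪 Ω¹ of the local ring back to 𝔪 Ω¹(X), against `ht`.
    have hclaim : ∀ η ∈ maximalIdeal S • (⊤ : Submodule S Ω[S⁄ℂ]),
        ∃ s ∉ m, ∃ θ ∈ m • (⊤ : Submodule A Ω[A⁄ℂ]), s • η = f θ := by
      intro η hη
      refine Submodule.smul_induction_on hη (fun c hc ξ _ ↦ ?_) ?_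
      · obtain ⟨x, s, rfl⟩ := IsLocalization.exists_mk'_eq m.primeCompl c
        obtain ⟨⟨θ, u⟩, hu⟩ := IsLocalizedModule.surj m.primeCompl f ξ
        have hx := (IsLocalization.AtPrime.mk'_mem_maximal_iff _ m x s).1 hc
        refine ⟨u * s, m.primeCompl.mul_mem u.2 s.2, x • θ,
          Submodule.smul_mem_smul hx trivial, ?_⟩
        have hu' : (u : A) • ξ = f θ := hu
        rw [map_smul, ← hu', mul_smul, ← algebraMap_smul S (s : A), ← mul_smul,
          IsLocalization.mk'_spec', algebraMap_smul, smul_comm]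
      · rintro ξ ξ' ⟨s, hs, θ, hθ, h⟩ ⟨s', hs', θ', hθ', h'⟩
        refine ⟨s * s', m.primeCompl.mul_mem hs hs', s' • θ + s • θ',
          add_mem (Submodule.smul_mem _ _ hθ) (Submodule.smul_mem _ _ hθ'), ?_⟩
        rw [map_add, map_smul, map_smul, ← h, ← h', smul_add, mul_smul, mul_smul,
          smul_comm s s' ξ]
    obtain ⟨s, hs, θ, hθ, h⟩ := hclaim _ hmem
    rw [← map_smul] at h
    obtain ⟨⟨u, hu⟩, huv⟩ := IsLocalizedModule.exists_of_eq (S := m.primeCompl) h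
    have h1 : (u * s) • KaehlerDifferential.D ℂ A t ∈ m • (⊤ : Submodule A Ω[A⁄ℂ]) := by
      rw [mul_smul]
      exact (show u • s • KaehlerDifferential.D ℂ A t = u • θ from huv) ▸
        Submodule.smul_mem _ _ hθ
    obtain ⟨r, i, hi, hri⟩ := hm.exists_inv (m.primeCompl.mul_mem hu hs)
    refine ht ?_
    rw [← one_smul A (KaehlerDifferential.D ℂ A t), ← hri, add_smul, mul_smul]
    exact add_mem (Submodule.smul_mem _ _ h1) (Submodule.smul_mem_smul hi trivial)
  · push Not at hall
    obtain ⟨i, hi⟩ := hall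
    obtain ⟨c, hc⟩ := (notMem_maximalIdeal.1 hi).exists_left_inv
    exact ⟨c • β.coord i, by simpa using hc⟩

end Smooth

variable {A : Type*} [CommRing A] [IsDomain A] [Algebra ℂ A] [Algebra.FiniteType ℂ A]

/-- Depth two excludes closed associated points of A/t: from a w = t c and b w = t d follows b c = a
d, hence a ∣ c and t ∣ w. -/
theorem dvd_of_locally_dvd (hdim : ringKrullDim A = 2) (hlci : IsLocallyCompleteIntersection A)
    {t : A} (ht : t ≠ 0) {E : Set (MaximalSpectrum A)} (hE : E.Finite) (z : A)
    (hz : ∀ m : MaximalSpectrum A, m ∉ E → ∃ s ∉ m.asIdeal, t ∣ s * z) : t ∣ z := by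
  have : IsNoetherianRing A := Algebra.FiniteType.isNoetherianRing ℂ A
  have : IsJacobsonRing A := isJacobsonRing_of_finiteType (A := ℂ)
  have key : ∀ x w : A, x • Ideal.Quotient.mk (Ideal.span {t}) w = 0 ↔ t ∣ x * w := by
    intro x w
    rw [← Ideal.mem_span_singleton, ← Ideal.Quotient.eq_zero_iff_mem]
    rfl
  rw [← Ideal.mem_span_singleton, ← Ideal.Quotient.eq_zero_iff_mem]
  refine eq_zero_of_locally_eq_zero (A := A) ?_ hE _ fun m hm ↦ ?_
  · intro m hm w hw
    obtain ⟨w, rfl⟩ := Ideal.Quotient.mk_surjective w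
    simp only [key] at hw ⊢
    obtain ⟨a, b, ha, hb, ha0, hab, -⟩ := exists_regular_pair_localization hdim hlci m
    refine exists_smul_dvd_of_dvd_localization ?_
    set τ := algebraMap A (Localization.AtPrime m) t
    have hτ : τ ≠ 0 := fun h ↦ ht (IsLocalization.injective (Localization.AtPrime m)
      m.primeCompl_le_nonZeroDivisors (h.trans (map_zero _).symm))
    have hdvd : ∀ c ∈ maximalIdeal (Localization.AtPrime m), τ ∣ c * algebraMap A _ w := by
      intro c hc
      obtain ⟨x, s, rfl⟩ := IsLocalization.exists_mk'_eq m.primeCompl c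
      obtain ⟨d, hd⟩ := hw x ((IsLocalization.AtPrime.mk'_mem_maximal_iff _ m x s).1 hc)
      refine ⟨IsLocalization.mk' _ d s, ?_⟩
      rw [mul_comm, IsLocalization.mul_mk'_eq_mk'_of_mul, IsLocalization.mul_mk'_eq_mk'_of_mul,
        mul_comm w, hd]
    obtain ⟨c, hc⟩ := hdvd a ha
    obtain ⟨d, hd⟩ := hdvd b hb
    have h1 : b * c = a * d := by
      refine mul_left_cancel₀ hτ ?_
      rw [mul_left_comm, ← hc, mul_left_comm τ a, ← hd]; ring
    obtain ⟨e, rfl⟩ := hab c ⟨d, h1⟩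
    exact ⟨e, mul_left_cancel₀ ha0 (by rw [hc]; ring)⟩
  · simpa only [key] using hz m hm

theorem kaehler_eq_zero_of_locally_eq_zero (hdim : ringKrullDim A = 2)
    (hlci : IsLocallyCompleteIntersection A) {E : Set (MaximalSpectrum A)} (hE : E.Finite)
    (ω : Ω[A⁄ℂ]) (hω : ∀ m : MaximalSpectrum A, m ∉ E → ∃ s ∉ m.asIdeal, s • ω = 0) : ω = 0 := by
  have : IsNoetherianRing A := Algebra.FiniteType.isNoetherianRing ℂ A
  have : IsJacobsonRing A := isJacobsonRing_of_finiteType (A := ℂ)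
  refine eq_zero_of_locally_eq_zero (A := A) ?_ hE _ hω
  intro m hm w hw
  obtain ⟨a, b, ha, hb, ha0, hab, hΩ⟩ := exists_regular_pair_localization hdim hlci m
  have hkill : ∀ c ∈ maximalIdeal (Localization.AtPrime m),
      c • KaehlerDifferential.map ℂ ℂ A (Localization.AtPrime m) w = 0 := by
    intro c hc
    obtain ⟨x, s, rfl⟩ := IsLocalization.exists_mk'_eq m.primeCompl c
    have hx := hw x ((IsLocalization.AtPrime.mk'_mem_maximal_iff _ m x s).1 hc)
    rw [IsLocalization.mk'_eq_mul_mk'_one, mul_comm, mul_smul, algebraMap_smul, ← map_smul, hx,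
      map_zero, smul_zero]
  have h0 := hΩ _ (hkill a ha) (hkill b hb)
  obtain ⟨s, hs⟩ := (IsLocalizedModule.eq_zero_iff m.primeCompl _).1 h0
  exact ⟨s, s.2, hs⟩

theorem exists_smul_eq_zero_of_isSmoothAt (m : Ideal A) [m.IsPrime]
    (hsm : Algebra.IsSmoothAt ℂ m) {t : A} (ht : t ≠ 0) (ω : Ω[A⁄ℂ]) (hω : t • ω = 0) :
    ∃ s ∉ m, s • ω = 0 := by
  have : Algebra.FormallySmooth ℂ (Localization.AtPrime m) := hsm
  have : Module.Free (Localization.AtPrime m) Ω[Localization.AtPrime m⁄ℂ] :=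
    Module.free_of_flat_of_isLocalRing
  let f := KaehlerDifferential.map ℂ ℂ A (Localization.AtPrime m)
  have h1 : algebraMap A (Localization.AtPrime m) t • f ω = 0 := by
    rw [algebraMap_smul, ← map_smul, hω, map_zero]
  have hτ : algebraMap A (Localization.AtPrime m) t ≠ 0 := fun h ↦
    ht (IsLocalization.injective (Localization.AtPrime m)
      m.primeCompl_le_nonZeroDivisors (h.trans (map_zero _).symm))
  have h0 := (smul_eq_zero.1 h1).resolve_left hτ
  obtain ⟨s, hs⟩ := (IsLocalizedModule.eq_zero_iff m.primeCompl f).1 h0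
  exact ⟨s, s.2, hs⟩

end RelCohomology

/-! ### Reducedness of smooth fibres; functions with zero differential -/

namespace RelCohomology
open IsLocalRing
open scoped TensorProduct

/-- Smooth algebras over a field are reduced. -/
theorem isReduced_of_smooth (S : Type*) [CommRing S] [Algebra ℂ S] [Algebra.Smooth ℂ S] :
    IsReduced S := by
  refine ⟨fun n hn ↦ ?_⟩
  let K := FractionRing ℂ[X]
  let ν : ℂ[X] ⊗[ℂ] S := 1 ⊗ₜ n
  have hν : IsNilpotent ν :=
    hn.map (Algebra.TensorProduct.includeRight : S →ₐ[ℂ] ℂ[X] ⊗[ℂ] S)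
  have hX : algebraMap ℂ[X] K Polynomial.X ≠ 0 := by
    simp
  -- The nilpotent n / X is integral over S[X]. Integral closure commutes with smooth base change
  -- and ℂ[X] is integrally closed, so n / X already lies in S[X]; setting X = 0 gives n = 0.
  let w : (ℂ[X] ⊗[ℂ] S) ⊗[ℂ[X]] K := ν ⊗ₜ (algebraMap ℂ[X] K Polynomial.X)⁻¹
  have hw : IsNilpotent w := by
    obtain ⟨k, hk⟩ := hν
    exact ⟨k, by rw [Algebra.TensorProduct.tmul_pow, hk, TensorProduct.zero_tmul]⟩
  have hwint : IsIntegral (ℂ[X] ⊗[ℂ] S) w := by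
    obtain ⟨k, hk⟩ := hw
    refine ⟨Polynomial.X ^ k, Polynomial.monic_X_pow k, by simp [hk]⟩
  obtain ⟨u, hu⟩ := (TensorProduct.toIntegralClosure_bijective_of_smooth (R := ℂ[X])
    (S := ℂ[X] ⊗[ℂ] S) (B := K)).2 ⟨w, hwint⟩
  have hrange : ∀ u : (ℂ[X] ⊗[ℂ] S) ⊗[ℂ[X]] integralClosure ℂ[X] K,
      ∃ s : ℂ[X] ⊗[ℂ] S, (TensorProduct.toIntegralClosure ℂ[X] (ℂ[X] ⊗[ℂ] S) K u :
        (ℂ[X] ⊗[ℂ] S) ⊗[ℂ[X]] K) = s ⊗ₜ 1 := by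
    intro u
    induction u with
    | zero => exact ⟨0, by simp⟩
    | add x y hx hy =>
      obtain ⟨a, ha⟩ := hx
      obtain ⟨b, hb⟩ := hy
      exact ⟨a + b, by rw [map_add, Subalgebra.coe_add, ha, hb, TensorProduct.add_tmul]⟩
    | tmul x y =>
      obtain ⟨r, hr⟩ := IsIntegrallyClosed.isIntegral_iff.1 y.2
      refine ⟨r • x, ?_⟩
      change x ⊗ₜ (y : K) = _
      rw [← hr, Algebra.algebraMap_eq_smul_one, TensorProduct.smul_tmul]
  obtain ⟨s, hs⟩ := hrange u
  rw [hu] at hs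
  have h2 : ν ⊗ₜ[ℂ[X]] (1 : K) = ((Polynomial.X : ℂ[X]) • s) ⊗ₜ[ℂ[X]] (1 : K) := by
    have := congrArg (fun z ↦ (Polynomial.X : ℂ[X]) • z) hs
    simp only [w] at this
    rw [← TensorProduct.tmul_smul, Algebra.smul_def, mul_inv_cancel₀ hX] at this
    rw [this, TensorProduct.smul_tmul']
  have h3 : ν = (Polynomial.X : ℂ[X]) • s :=
    Algebra.TensorProduct.includeLeft_injective (R := ℂ[X]) (S := ℂ[X]) (A := ℂ[X] ⊗[ℂ] S) (B := K)
      (IsFractionRing.injective ℂ[X] K) h2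
  let ε : (ℂ[X] ⊗[ℂ] S) →ₐ[ℂ] S := Algebra.TensorProduct.lift (Polynomial.aeval (0 : S))
    (AlgHom.id ℂ S) fun _ _ ↦ Commute.all _ _
  have h4 : ε ν = n := by simp [ε, ν]
  have h5 : ∀ s : ℂ[X] ⊗[ℂ] S, ε ((Polynomial.X : ℂ[X]) • s) = 0 := by
    intro s
    induction s with
    | zero => simp
    | add x y hx hy => rw [smul_add, map_add, hx, hy, add_zero]
    | tmul p a => rw [TensorProduct.smul_tmul']; simp [ε]
  rw [← h4, h3, h5]

/-- The quotient of a formally smooth algebra by a function with nonvanishing differential is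
formally smooth. -/
theorem formallySmooth_of_ker_eq_span {L S : Type*} [CommRing L] [CommRing S] [Algebra ℂ L]
    [Algebra ℂ S] [Algebra L S] [IsScalarTower ℂ L S] [Algebra.FormallySmooth ℂ L]
    (hsurj : Function.Surjective (algebraMap L S)) (t : L)
    (hker : RingHom.ker (algebraMap L S) = Ideal.span {t}) (φ : Ω[L⁄ℂ] →ₗ[L] L)
    (hφ : φ (KaehlerDifferential.D ℂ L t) = 1) : Algebra.FormallySmooth ℂ S := by
  rw [Algebra.FormallySmooth.iff_split_injection hsurj]
  have ht : t ∈ RingHom.ker (algebraMap L S) := hker ▸ Ideal.mem_span_singleton_self t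
  let τ : (RingHom.ker (algebraMap L S)).Cotangent := Ideal.toCotangent _ ⟨t, ht⟩
  have hτ : ∀ x ∈ RingHom.ker (algebraMap L S), x • τ = 0 := by
    intro x hx
    rw [← map_smul, Ideal.toCotangent_eq_zero, pow_two]
    exact Ideal.mul_mem_mul hx ht
  let g₀ := (Algebra.linearMap L S).ker.liftQ (LinearMap.toSpanSingleton L _ τ) fun x hx ↦ by
    simpa using hτ x hx
  let g : S →ₗ[L] (RingHom.ker (algebraMap L S)).Cotangent :=
    g₀ ∘ₗ ((Algebra.linearMap L S).quotKerEquivOfSurjective hsurj).symm.toLinearMap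
  have hg : ∀ x : L, g (algebraMap L S x) = x • τ := by
    intro x
    have : ((Algebra.linearMap L S).quotKerEquivOfSurjective hsurj).symm (algebraMap L S x) =
        Submodule.Quotient.mk x := by
      rw [LinearEquiv.symm_apply_eq]; rfl
    change g₀ (((Algebra.linearMap L S).quotKerEquivOfSurjective hsurj).symm
      (algebraMap L S x)) = _
    rw [this]
    rfl
  -- The class τ of t generates the conormal module, and φ(dt) = 1 makes s ⊗ θ ↦ s φ(θ) τ a
  -- retraction onto it.
  refine ⟨g ∘ₗ (TensorProduct.rid L S).toLinearMap ∘ₗ φ.lTensor S, ?_⟩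
  ext c
  obtain ⟨⟨c, hc⟩, rfl⟩ := Ideal.toCotangent_surjective _ c
  obtain ⟨d, rfl⟩ := Ideal.mem_span_singleton'.1 (hker ▸ hc)
  simp only [LinearMap.comp_apply, KaehlerDifferential.kerCotangentToTensor_toCotangent,
    LinearMap.lTensor_tmul, LinearEquiv.coe_coe, TensorProduct.rid_tmul, LinearMap.id_apply]
  rw [← Algebra.algebraMap_eq_smul_one, hg, Derivation.leibniz, map_add, map_smul, map_smul, hφ,
    add_smul, smul_eq_mul, smul_eq_mul, mul_one, mul_comm t, mul_smul, hτ t ht, smul_zero,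
    add_zero, ← map_smul]
  rfl

variable {A : Type*} [CommRing A] [Algebra ℂ A] [Algebra.FiniteType ℂ A]

/-- The quotient A/t is smooth at m, hence smooth and so reduced on a neighbourhood of m. -/
theorem exists_dvd_mul_of_dvd_pow (m : Ideal A) [hm : m.IsMaximal]
    (hsm : Algebra.IsSmoothAt ℂ m) (t : A) (htm : t ∈ m)
    (ht : KaehlerDifferential.D ℂ A t ∉ m • (⊤ : Submodule A Ω[A⁄ℂ])) {z : A} {k : ℕ}
    (hz : t ∣ z ^ k) : ∃ s ∉ m, t ∣ s * z := by
  obtain ⟨φ, hφ⟩ := exists_linearMap_D_eq_one m hsm t ht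
  have : IsNoetherianRing A := Algebra.FiniteType.isNoetherianRing ℂ A
  let B := A ⧸ Ideal.span {t}
  let π : A →+* B := Ideal.Quotient.mk _
  have hπ : Function.Surjective π := Ideal.Quotient.mk_surjective
  have hkerπ : RingHom.ker π = Ideal.span {t} := Ideal.mk_ker
  have hle : RingHom.ker π ≤ m := by
    rw [hkerπ]; exact (Ideal.span_singleton_le_iff_mem m).2 htm
  have hp : (m.map π).IsPrime := Ideal.map_isPrime_of_surjective hπ hle
  have hcomap : (m.map π).comap π = m := by
    rw [Ideal.comap_map_of_surjective' π hπ, sup_eq_left]; exact hle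
  generalize m.map π = p at hp hcomap
  subst hcomap
  let L := Localization.AtPrime (p.comap π)
  let S := Localization.AtPrime p
  let ψ : L →+* S := Localization.localRingHom (p.comap π) p π rfl
  let _ : Algebra L S := ψ.toAlgebra
  have : IsScalarTower ℂ L S := by
    refine .of_algebraMap_eq fun c ↦ ?_
    change _ = ψ _
    rw [IsScalarTower.algebraMap_apply ℂ A L, Localization.localRingHom_to_map,
      IsScalarTower.algebraMap_apply ℂ B S]
    rfl
  have : Algebra.FormallySmooth ℂ L := hsm
  have hker : RingHom.ker (algebraMap L S) = Ideal.span {algebraMap A L t} := by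
    change RingHom.ker ψ = _
    rw [ker_localRingHom π hπ p, hkerπ, Ideal.map_span, Set.image_singleton]
  have : Algebra.IsSmoothAt ℂ p :=
    formallySmooth_of_ker_eq_span (localRingHom_surjective π hπ p) _ hker φ hφ
  have : Algebra.FinitePresentation ℂ B := Algebra.FinitePresentation.of_finiteType.1 inferInstance
  obtain ⟨b, hb, hsmooth⟩ := Algebra.IsSmoothAt.exists_notMem_smooth ℂ p
  have hred := isReduced_of_smooth (Localization.Away b)
  have hnil : IsNilpotent (algebraMap B (Localization.Away b) (π z)) := by
    refine ⟨k, ?_⟩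
    rw [← map_pow, ← map_pow, Ideal.Quotient.eq_zero_iff_mem.2 (Ideal.mem_span_singleton.2 hz),
      map_zero]
  have h0 := hnil.eq_zero
  rw [IsLocalization.map_eq_zero_iff (Submonoid.powers b)] at h0
  obtain ⟨⟨_, j, rfl⟩, hj⟩ := h0
  obtain ⟨c, rfl⟩ := hπ b
  refine ⟨c ^ j, fun h ↦ hb (hp.mem_of_pow_mem j (by rw [← map_pow]; exact h)), ?_⟩
  rw [← Ideal.mem_span_singleton, ← Ideal.Quotient.eq_zero_iff_mem, map_mul, map_pow]
  exact hj

/-- In a finitely generated field extension of `ℂ` only the constants have zero differential. -/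
theorem exists_algebraMap_eq_of_D_eq_zero {K : Type*} [Field K] [Algebra ℂ K]
    [Algebra.EssFiniteType ℂ K] (x : K) (hx : KaehlerDifferential.D ℂ K x = 0) :
    ∃ c : ℂ, algebraMap ℂ K c = x := by
  by_cases halg : IsAlgebraic ℂ x
  · exact minpoly.mem_range_of_degree_eq_one ℂ x (IsAlgClosed.degree_eq_one_of_irreducible ℂ
      (minpoly.irreducible halg.isIntegral))
  · exfalso
    -- For transcendental x, the field K is formally smooth over ℂ(x), hence over ℂ[X]. So dX stays
    -- nonzero in Ω¹ of K, where it becomes dx.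
    let R := ℂ[X]
    let F := FractionRing R
    let _ : Algebra R K := (Polynomial.aeval x).toRingHom.toAlgebra
    have : IsScalarTower ℂ R K := .of_algHom (Polynomial.aeval x)
    have : FaithfulSMul R K := (faithfulSMul_iff_algebraMap_injective _ _).2
      (transcendental_iff_injective.1 halg)
    let _ := FractionRing.liftAlgebra R K
    have := FractionRing.isScalarTower_liftAlgebra R K
    have : IsScalarTower ℂ F K := .to₁₃₄ ℂ R F K
    have : CharZero F := IsFractionRing.charZero R
    have : Algebra.EssFiniteType F K := Algebra.EssFiniteType.of_comp ℂ F K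
    have : Algebra.FormallySmooth F K := inferInstance
    have : Algebra.FormallySmooth R F := .of_isLocalization (nonZeroDivisors R)
    have : Algebra.FormallySmooth R K := .comp R F K
    have hinj : Function.Injective (KaehlerDifferential.mapBaseChange ℂ R K) := by
      rw [injective_iff_map_eq_zero]
      intro z hz
      obtain ⟨h, rfl⟩ := (Algebra.H1Cotangent.exact_δ_mapBaseChange ℂ R K z).1 hz
      rw [Subsingleton.elim h 0, map_zero]
    have h1 : (1 : K) ⊗ₜ[R] KaehlerDifferential.D ℂ R Polynomial.X = 0 := by
      apply hinj
      rw [map_zero, KaehlerDifferential.mapBaseChange_tmul, KaehlerDifferential.map_D, one_smul]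
      change KaehlerDifferential.D ℂ K (Polynomial.aeval x Polynomial.X) = 0
      rw [Polynomial.aeval_X, hx]
    have h2 : TensorProduct.rid R K ((KaehlerDifferential.polynomialEquiv ℂ).toLinearMap.lTensor K
        ((1 : K) ⊗ₜ[R] KaehlerDifferential.D ℂ R Polynomial.X)) = 0 := by
      rw [h1, map_zero, map_zero]
    rw [LinearMap.lTensor_tmul, TensorProduct.rid_tmul, LinearEquiv.coe_coe,
      KaehlerDifferential.polynomialEquiv_D, Polynomial.derivative_X, one_smul] at h2
    exact one_ne_zero h2

/-- In the residue field of P both t and dt become zero, so the image of g has zero differential. -/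
theorem exists_sub_mem_of_D_eq (t g a : A) (ω : Ω[A⁄ℂ])
    (h : KaehlerDifferential.D ℂ A g = t • ω + a • KaehlerDifferential.D ℂ A t)
    (P : Ideal A) [P.IsPrime] (htP : t ∈ P) : ∃ c : ℂ, g - algebraMap ℂ A c ∈ P := by
  let K := FractionRing (A ⧸ P)
  have ht : algebraMap A K t = 0 := by
    rw [IsScalarTower.algebraMap_apply A (A ⧸ P) K]
    change algebraMap (A ⧸ P) K (Ideal.Quotient.mk P t) = 0
    rw [Ideal.Quotient.eq_zero_iff_mem.2 htP, map_zero]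
  have hD : KaehlerDifferential.D ℂ K (algebraMap A K g) = 0 := by
    have := congrArg (KaehlerDifferential.map ℂ ℂ A K) h
    rw [map_add, map_smul, map_smul, KaehlerDifferential.map_D, KaehlerDifferential.map_D,
      ht, map_zero, smul_zero, add_zero, ← algebraMap_smul K t, ht, zero_smul] at this
    exact this
  have : Algebra.EssFiniteType (A ⧸ P) K := .of_isLocalization _ (nonZeroDivisors (A ⧸ P))
  have : Algebra.EssFiniteType ℂ K := .comp ℂ (A ⧸ P) K
  obtain ⟨c, hc⟩ := exists_algebraMap_eq_of_D_eq_zero _ hD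
  refine ⟨c, ?_⟩
  rw [← Ideal.Quotient.eq_zero_iff_mem]
  apply IsFractionRing.injective (A ⧸ P) K
  rw [map_zero, map_sub, map_sub]
  exact sub_eq_zero.2 hc.symm

end RelCohomology

/-! ### Newton approximation and the induction on r -/

namespace RelCohomology
open KaehlerDifferential

section Newton
variable {A : Type*} [CommRing A] [Algebra ℂ A]

/-- If `g` satisfies a separable equation modulo `t`, it may be changed modulo `t` so that
its differential becomes a multiple of `dt` modulo a given power of `t`. -/
theorem exists_sub_D_eq (t g : A) (p : ℂ[X]) (hp : p.Separable) (hpg : t ∣ Polynomial.aeval g p)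
    (hrad : ∀ (z : A) (k : ℕ), t ∣ z ^ k → t ∣ z) (N : ℕ) :
    ∃ (g' h a : A) (η : Ω[A⁄ℂ]), g = g' + t * h ∧
      D ℂ A g' = t ^ (N + 1) • η + a • D ℂ A t := by
  obtain ⟨u, v, huv⟩ := hp
  let Q := A ⧸ Ideal.span {t ^ (N + 1)}
  let π : A →ₐ[ℂ] Q := Ideal.Quotient.mkₐ ℂ _
  have hπ : ∀ z, π z = 0 ↔ t ^ (N + 1) ∣ z := fun z ↦ by
    rw [← Ideal.mem_span_singleton]; exact Ideal.Quotient.eq_zero_iff_mem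
  have hnil : IsNilpotent (Polynomial.aeval (π g) p) := by
    refine ⟨N + 1, ?_⟩
    rw [Polynomial.aeval_algHom_apply, ← map_pow, hπ]
    exact pow_dvd_pow_of_dvd hpg _
  have hunit : IsUnit (Polynomial.aeval (π g) (Polynomial.derivative p)) := by
    have h1 := congrArg (Polynomial.aeval (π g)) huv
    rw [map_add, map_mul, map_mul, map_one] at h1
    have h2 : IsUnit (Polynomial.aeval (π g) v *
        Polynomial.aeval (π g) (Polynomial.derivative p)) := by
      rw [← eq_sub_iff_add_eq'] at h1
      rw [h1]
      exact ((Commute.all _ _).isNilpotent_mul_left hnil).isUnit_one_sub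
    exact isUnit_of_mul_isUnit_right h2
  -- Newton's method modulo t^(N+1): p(g) is nilpotent there, and p'(g) is a unit by the Bézout
  -- relation u p + v p' = 1.
  obtain ⟨r, ⟨hr1, hr2⟩, -⟩ := Polynomial.existsUnique_nilpotent_sub_and_aeval_eq_zero hnil hunit
  obtain ⟨g', rfl⟩ := Ideal.Quotient.mkₐ_surjective ℂ _ r
  obtain ⟨k, hk⟩ := hr1
  rw [← map_sub, ← map_pow] at hk
  obtain ⟨h, hh⟩ := hrad _ k ((dvd_pow_self t (Nat.succ_ne_zero N)).trans ((hπ _).1 hk))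
  rw [Polynomial.aeval_algHom_apply] at hr2
  obtain ⟨w, hw⟩ := (hπ _).1 hr2
  have hD : Polynomial.aeval g' (Polynomial.derivative p) • D ℂ A g' =
      t ^ (N + 1) • D ℂ A w + (w * ((N + 1 : ℕ) * t ^ N)) • D ℂ A t := by
    rw [← Derivation.map_aeval, hw, Derivation.leibniz, Derivation.leibniz_pow]
    simp only [Nat.add_sub_cancel, smul_smul, ← Nat.cast_smul_eq_nsmul A]
  -- Multiply dg' by u p + v p' = 1 at g', then insert p(g') = t^(N+1) w and the formula for p'(g')
  -- dg'.
  refine ⟨g', h, Polynomial.aeval g' v * (w * ((N + 1 : ℕ) * t ^ N)),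
    (Polynomial.aeval g' u * w) • D ℂ A g' + Polynomial.aeval g' v • D ℂ A w, ?_, ?_⟩
  · rw [← hh]; ring
  · have h1 := congrArg (Polynomial.aeval g') huv
    rw [map_add, map_mul, map_mul, map_one] at h1
    have h2 : D ℂ A g' = (Polynomial.aeval g' u * Polynomial.aeval g' p) • D ℂ A g' +
        Polynomial.aeval g' v • (Polynomial.aeval g' (Polynomial.derivative p) • D ℂ A g') := by
      rw [smul_smul, ← add_smul, h1, one_smul]
    rw [hD, hw] at h2
    refine h2.trans ?_
    simp only [smul_add, smul_smul]
    rw [← add_assoc]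
    congr 3 <;> ring

end Newton

variable {A : Type*} [CommRing A] [IsDomain A] [Algebra ℂ A] [Algebra.FiniteType ℂ A]

theorem sub_algebraMap_ne_zero {A : Type*} [CommRing A] [IsDomain A] [Algebra ℂ A] {f : A}
    (hf : IsDominantFunction f) (y : ℂ) : f - algebraMap ℂ A y ≠ 0 := by
  intro h
  have hd : DenseRange (PrimeSpectrum.comap (Polynomial.aeval f : ℂ[X] →ₐ[ℂ] A).toRingHom) := hf
  rw [PrimeSpectrum.denseRange_comap_iff_ker_le_nilRadical] at hd
  have h1 : Polynomial.X - Polynomial.C y ∈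
      RingHom.ker (Polynomial.aeval f : ℂ[X] →ₐ[ℂ] A).toRingHom := by
    rw [RingHom.mem_ker]
    simpa using h
  have h2 := hd h1
  rw [nilradical_eq_zero] at h2
  exact Polynomial.X_sub_C_ne_zero y h2

section Fibre
variable {f : A} {y : ℂ}

theorem D_sub_algebraMap {A : Type*} [CommRing A] [Algebra ℂ A] (f : A) (y : ℂ) :
    D ℂ A (f - algebraMap ℂ A y) = D ℂ A f := by
  rw [map_sub, Derivation.map_algebraMap, sub_zero]

theorem smooth_of_notMem {A : Type*} [CommRing A] [Algebra ℂ A] {f : A} {y : ℂ}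
    {m : MaximalSpectrum A} (hm : m ∉ fibre f y ∩ singularSet f)
    (ht : f - algebraMap ℂ A y ∈ m.asIdeal) :
    Algebra.IsSmoothAt ℂ m.asIdeal ∧
      D ℂ A (f - algebraMap ℂ A y) ∉ m.asIdeal • (⊤ : Submodule A Ω[A⁄ℂ]) := by
  have h : m ∉ singularSet f := fun h ↦ hm ⟨ht, h⟩
  rw [singularSet, Set.mem_ofPred_eq, not_or, not_not] at h
  exact ⟨h.1, by rw [D_sub_algebraMap]; exact h.2⟩

theorem dvd_of_dvd_pow (hdim : ringKrullDim A = 2) (hlci : IsLocallyCompleteIntersection A)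
    (hf : IsDominantFunction f) (hfin : (fibre f y ∩ singularSet f).Finite) (z : A) (k : ℕ)
    (hz : f - algebraMap ℂ A y ∣ z ^ k) : f - algebraMap ℂ A y ∣ z := by
  refine dvd_of_locally_dvd hdim hlci (sub_algebraMap_ne_zero hf y) hfin z fun m hm ↦ ?_
  by_cases ht : f - algebraMap ℂ A y ∈ m.asIdeal
  · obtain ⟨h1, h2⟩ := smooth_of_notMem hm ht
    exact exists_dvd_mul_of_dvd_pow m.asIdeal h1 _ ht h2 hz
  · exact ⟨_, ht, dvd_mul_right _ _⟩

/-- Off the finite set a local derivation with value 1 on t turns a dt = t ω into a = t φ(ω). -/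
theorem dvd_of_smul_D_eq (hdim : ringKrullDim A = 2) (hlci : IsLocallyCompleteIntersection A)
    (hf : IsDominantFunction f) (hfin : (fibre f y ∩ singularSet f).Finite) (a : A) (ω : Ω[A⁄ℂ])
    (h : a • D ℂ A (f - algebraMap ℂ A y) = (f - algebraMap ℂ A y) • ω) :
    f - algebraMap ℂ A y ∣ a := by
  refine dvd_of_locally_dvd hdim hlci (sub_algebraMap_ne_zero hf y) hfin a fun m hm ↦ ?_
  by_cases ht : f - algebraMap ℂ A y ∈ m.asIdeal
  · obtain ⟨h1, h2⟩ := smooth_of_notMem hm ht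
    obtain ⟨φ, hφ⟩ := exists_linearMap_D_eq_one m.asIdeal h1 _ h2
    refine exists_smul_dvd_of_dvd_localization
      ⟨φ (KaehlerDifferential.map ℂ ℂ A (Localization.AtPrime m.asIdeal) ω), ?_⟩
    have h3 := congrArg (fun η ↦ φ (KaehlerDifferential.map ℂ ℂ A
      (Localization.AtPrime m.asIdeal) η)) h
    simp only [map_smul, KaehlerDifferential.map_D] at h3
    rw [← algebraMap_smul (Localization.AtPrime m.asIdeal) a,
      ← algebraMap_smul (Localization.AtPrime m.asIdeal) (f - algebraMap ℂ A y), map_smul,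
      map_smul, hφ, smul_eq_mul, mul_one, smul_eq_mul] at h3
    exact h3
  · exact ⟨_, ht, dvd_mul_right _ _⟩

theorem kaehler_eq_zero_of_sub_smul_eq_zero (hdim : ringKrullDim A = 2)
    (hlci : IsLocallyCompleteIntersection A) (hf : IsDominantFunction f)
    (hfin : (fibre f y ∩ singularSet f).Finite) (ω : Ω[A⁄ℂ])
    (h : (f - algebraMap ℂ A y) • ω = 0) : ω = 0 := by
  refine kaehler_eq_zero_of_locally_eq_zero hdim hlci hfin ω fun m hm ↦ ?_
  by_cases ht : f - algebraMap ℂ A y ∈ m.asIdeal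
  · exact exists_smul_eq_zero_of_isSmoothAt m.asIdeal (smooth_of_notMem hm ht).1
      (sub_algebraMap_ne_zero hf y) ω h
  · exact ⟨_, ht, h⟩

/-- A function whose differential vanishes on the fibre takes finitely many values there. -/
theorem exists_separable_dvd_aeval (hdim : ringKrullDim A = 2)
    (hlci : IsLocallyCompleteIntersection A) (hf : IsDominantFunction f)
    (hfin : (fibre f y ∩ singularSet f).Finite) (g a : A) (ω : Ω[A⁄ℂ])
    (h : D ℂ A g = (f - algebraMap ℂ A y) • ω + a • D ℂ A (f - algebraMap ℂ A y)) :
    ∃ p : ℂ[X], p.Separable ∧ f - algebraMap ℂ A y ∣ Polynomial.aeval g p := by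
  classical
  set t := f - algebraMap ℂ A y with ht
  have : IsNoetherianRing A := Algebra.FiniteType.isNoetherianRing ℂ A
  have hM : (Ideal.span {t}).minimalPrimes.Finite :=
    Ideal.finite_minimalPrimes_of_isNoetherianRing A _
  have hc : ∀ P : Ideal A, ∃ c : ℂ, P ∈ (Ideal.span {t}).minimalPrimes →
      g - algebraMap ℂ A c ∈ P := by
    intro P
    by_cases hP : P ∈ (Ideal.span {t}).minimalPrimes
    · have := hP.1.1
      obtain ⟨c, hc⟩ := exists_sub_mem_of_D_eq t g a ω h P
        (hP.1.2 (Ideal.mem_span_singleton_self t))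
      exact ⟨c, fun _ ↦ hc⟩
    · exact ⟨0, fun h ↦ absurd h hP⟩
  choose c hc using hc
  -- The product runs over the set of values, not over the components: repeated values would destroy
  -- separability.
  refine ⟨∏ x ∈ hM.toFinset.image c, (Polynomial.X - Polynomial.C x),
    Polynomial.separable_prod_X_sub_C_iff'.2 fun _ _ _ _ h ↦ h, ?_⟩
  have hrad : Polynomial.aeval g (∏ x ∈ hM.toFinset.image c, (Polynomial.X - Polynomial.C x)) ∈
      (Ideal.span {t}).radical := by
    rw [← Ideal.sInf_minimalPrimes, Ideal.mem_sInf]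
    intro P hP
    rw [map_prod]
    refine P.mem_of_dvd (Finset.dvd_prod_of_mem _
      (Finset.mem_image_of_mem c (hM.mem_toFinset.2 hP))) ?_
    simpa using hc P hP
  obtain ⟨k, hk⟩ := hrad
  exact dvd_of_dvd_pow hdim hlci hf hfin _ k (Ideal.mem_span_singleton.1 hk)

theorem exists_eq_smul_add_of_pow_smul_eq (hdim : ringKrullDim A = 2)
    (hlci : IsLocallyCompleteIntersection A) (hf : IsDominantFunction f)
    (hfin : (fibre f y ∩ singularSet f).Finite) (r : ℕ) :
    ∀ (ω : Ω[A⁄ℂ]) (g a : A), (f - algebraMap ℂ A y) ^ r • ω = D ℂ A g + a • D ℂ A f →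
      ∃ (η : Ω[A⁄ℂ]) (h b : A), ω = (f - algebraMap ℂ A y) • η + (D ℂ A h + b • D ℂ A f) := by
  induction r with
  | zero =>
    intro ω g a h
    exact ⟨0, g, a, by simpa using h⟩
  | succ r ih =>
    intro ω g a h
    rw [← D_sub_algebraMap f y] at h ih ⊢
    have hC2 := dvd_of_smul_D_eq (y := y) hdim hlci hf hfin
    have hC3 := kaehler_eq_zero_of_sub_smul_eq_zero (y := y) hdim hlci hf hfin
    obtain ⟨p, hp, hpg⟩ := exists_separable_dvd_aeval (y := y) hdim hlci hf hfin g (-a)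
      ((f - algebraMap ℂ A y) ^ r • ω) (by
        rw [smul_smul, ← pow_succ', h, neg_smul]; abel)
    -- The parameter r + 1 yields t^(r+2), one power more than t^(r+1), so that a factor t is left
    -- in front of η.
    obtain ⟨g', k, a', η, hg, hg'⟩ := exists_sub_D_eq _ g p hp hpg
      (dvd_of_dvd_pow hdim hlci hf hfin) (r + 1)
    generalize f - algebraMap ℂ A y = t at *
    have h1 : (-(a' + k + a)) • D ℂ A t = t • (D ℂ A k - t ^ r • (ω - t • η)) := by
      rw [hg, map_add, Derivation.leibniz, hg'] at h
      have h' : t • t ^ r • ω = t • t ^ r • t • η + a' • D ℂ A t + (t • D ℂ A k + k • D ℂ A t) +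
          a • D ℂ A t := by
        simp only [smul_smul] at h ⊢
        rw [← pow_succ', h]
        congr 4
        ring
      rw [smul_sub, smul_sub, smul_sub, h']
      module
    obtain ⟨b, hb⟩ := hC2 _ _ h1
    have h2 : t ^ r • (ω - t • η) = D ℂ A k + (-b) • D ℂ A t := by
      rw [hb, mul_smul] at h1
      have h3 := hC3 (D ℂ A k - t ^ r • (ω - t • η) - b • D ℂ A t) (by
        rw [smul_sub, ← h1, sub_self])
      rw [sub_sub, sub_eq_zero] at h3
      rw [h3]
      module
    obtain ⟨η', h', b', hη'⟩ := ih _ _ _ h2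
    refine ⟨η + η', h', b', ?_⟩
    rw [smul_add, add_assoc, ← hη', add_sub_cancel]

end Fibre

end RelCohomology

theorem mainTheorem6 (A : Type*) [CommRing A] [IsDomain A] [Algebra ℂ A] [Algebra.FiniteType ℂ A]
    (hdim : ringKrullDim A = 2)
    (hlci : RelCohomology.IsLocallyCompleteIntersection A)
    (f : A) (hf : RelCohomology.IsDominantFunction f) (y : ℂ)
    (hfin : (RelCohomology.fibre f y ∩ RelCohomology.singularSet f).Finite) :
    RelCohomology.PropertyP f (RelCohomology.H1 f) y := by
  intro r ω hω
  obtain ⟨ω, rfl⟩ := Submodule.Quotient.mk_surjective _ ω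
  rw [← Submodule.Quotient.mk_smul, Submodule.Quotient.mk_eq_zero] at hω
  obtain ⟨g, a, hga⟩ := hω
  obtain ⟨η, h, b, hη⟩ := RelCohomology.exists_eq_smul_add_of_pow_smul_eq hdim hlci hf hfin r ω g a
    hga
  refine ⟨Submodule.Quotient.mk η, ?_⟩
  rw [← Submodule.Quotient.mk_smul, Submodule.Quotient.eq]
  refine ⟨h, b, ?_⟩
  rw [hη]
  exact add_sub_cancel_left _ _
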